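/- Let $n\ge 1$ be an integer, $t_0<T$, and let $a_0,a_1,\dots,a_n$ be real-valued continuous functions on $[t_0,T]$. Consider the equation $$y'+\sum_{k=0}^n a_k(t)y^k=0. \tag{1.1}$$ A solution $y$ of (1.1) on $[t_0,T]$ is called closed if $y(t_0)=y(T)$. For $t\in[t_0,T]$ and $c\in\mathbb R$ put $$\alpha(t)=\sum_{k=2}^n|a_k(t)|-a_1(t),\qquad J(t)=\int_{t_0}^t\exp\Bigl\{-\int_{t_0}^\tau\alpha(s)\,ds\Bigr\}a_0(\tau)\,d\tau,$$ $$\theta_c(t)=\exp\Bigl\{\int_{t_0}^t\alpha(\tau)\,d\tau\Bigr\}\bigl[c-J(t)\bigr],\qquad \theta_c^-(t)=-\exp\Bigl\{\int_{t_0}^t\alpha(\tau)\,d\tau\Bigr\}\bigl[c+J(t)\bigr].$$ Let $c^+,c^-$ be real numbers with $c^+\ge\max_{t\in[t_0,T]}J(t)$ and $c^-\ge-\min_{t\in[t_0,T]}J(t)$, and assume: (19⁰) $\theta_{c^+}(t)\le 1$ and $|\theta^-_{c^-}(t)|\le 1$ for all $t\in[t_0,T]$; (20⁰) $\displaystyle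 c^+\Bigl(1-\exp\Bigl\{-\int_{t_0}^T\alpha(\tau)\,d\tau\Bigr\}\Bigr)\le J(T)$ and $\displaystyle c^-\Bigl(1-\exp\Bigl\{-\int_{t_0}^T\alpha(\tau)\,d\tau\Bigr\}\Bigr)\le -J(T)$. Then (1.1) has a closed solution $y_*$ on $[t_0,T]$ such that $$\theta^-_{c^-}(t)\le y_*(t)\le\theta_{c^+}(t),\qquad t\in[t_0,T].$$ Moreover, if $\theta^-_{c^-}(t_0)<y_*(t_0)$, then $\theta^-_{c^-}(t)<y_*(t)$ for all $t\in[t_0,T]$, and if $y_*(t_0)<\theta_{c^+}(t_0)$, then $y_*(t)<\theta_{c^+}(t)$ for all $t\in[t_0,T]$. -/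

import Mathlib

noncomputable section

namespace PolyODE

/-- `y` solves `y' + ∑_{k=0}^n a_k(t) y^k = 0` on the closed interval `[t₀, T]`
(derivatives at the end points are one-sided). -/
def IsSolutionOn (n : ℕ) (a : ℕ → ℝ → ℝ) (t₀ T : ℝ) (y : ℝ → ℝ) : Prop :=
  ∀ t ∈ Set.Icc t₀ T,
    HasDerivWithinAt y (-∑ k ∈ Finset.range (n + 1), a k t * y t ^ k) (Set.Icc t₀ T) t

/-- A closed solution on `[t₀, T]`: a solution on `[t₀, T]` with `y(t₀) = y(T)`. -/
def IsClosedSolutionOn (n : ℕ) (a : ℕ → ℝ → ℝ) (t₀ T : ℝ) (y : ℝ → ℝ) : Prop :=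
  IsSolutionOn n a t₀ T y ∧ y t₀ = y T

/-- `α(t) = ∑_{k=2}^n |a_k(t)| - a_1(t)`. -/
def alpha (n : ℕ) (a : ℕ → ℝ → ℝ) (t : ℝ) : ℝ :=
  (∑ k ∈ Finset.Icc 2 n, |a k t|) - a 1 t

/-- `J(t) = ∫_{t₀}^t exp(-∫_{t₀}^τ α(s) ds) a_0(τ) dτ`. -/
def weightedInt (n : ℕ) (a : ℕ → ℝ → ℝ) (t₀ t : ℝ) : ℝ :=
  ∫ τ in t₀..t, Real.exp (-∫ s in t₀..τ, alpha n a s) * a 0 τ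

/-- `θ_c(t) = exp(∫_{t₀}^t α(τ) dτ) (c - J(t))`. -/
def theta (n : ℕ) (a : ℕ → ℝ → ℝ) (t₀ c t : ℝ) : ℝ :=
  Real.exp (∫ τ in t₀..t, alpha n a τ) * (c - weightedInt n a t₀ t)

/-- `θ⁻_c(t) = -exp(∫_{t₀}^t α(τ) dτ) (c + J(t))`. -/
def thetaMinus (n : ℕ) (a : ℕ → ℝ → ℝ) (t₀ c t : ℝ) : ℝ :=
  -Real.exp (∫ τ in t₀..t, alpha n a τ) * (c + weightedInt n a t₀ t)

end PolyODE

end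

open Set

namespace PolyODE

/-! For `|x| ≤ 1` and `k ≥ 2` one has `|a_k x^k| ≤ |a_k| |x|`, so the right side of the equation is
at most `α x - a₀` on `[0, 1]` and at least `α x - a₀` on `[-1, 0]`. Every `θ_c` solves `θ' = α θ -
a₀`; hence `θ_{c⁺}` is an upper solution and `θ⁻_{c⁻} = θ_{-c⁻}` a lower one. The end conditions say
that the upper one does not increase, and the lower one does not decrease, from `t₀` to `T`. The
Poincaré map therefore sends `[-c⁻, c⁺]` into itself and has a fixed point
(`exists_closed_solution_between`). Truncating the unknown to `[-1, 1]` makes the field bounded and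
Lipschitz, so solutions are global; the barriers keep the solution where truncation changes nothing.
-/

/-- A function with `-K |w| ≤ w'` that is initially positive stays positive. -/
theorem pos_of_neg_mul_abs_le_deriv {w w' : ℝ → ℝ} {a b K : ℝ}
    (hw : ∀ t ∈ Icc a b, HasDerivWithinAt w (w' t) (Icc a b) t)
    (hK : ∀ t ∈ Icc a b, -(K * |w t|) ≤ w' t) (h0 : 0 < w a) :
    ∀ t ∈ Icc a b, 0 < w t := by
  -- The rate `K + 1` instead of `K` makes the inequality at a contact point strict.
  have hB : ∀ x : ℝ, HasDerivAt (fun t => -(w a * Real.exp (-(K + 1) * (t - a))))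
      (-(w a * (Real.exp (-(K + 1) * (x - a)) * (-(K + 1) * 1)))) x := fun x =>
    (((((hasDerivAt_id x).sub_const a).const_mul (-(K + 1))).exp).const_mul (w a)).neg
  have key := image_le_of_deriv_right_lt_deriv_boundary (f := fun t => -w t)
    (f' := fun t => -w' t) (a := a) (b := b)
    (fun t ht => (hw t ht).neg.continuousWithinAt)
    (fun t ht => ((hw t (Ico_subset_Icc_self ht)).neg).mono_of_mem_nhdsWithin
      (Icc_mem_nhdsGE_of_mem ht))
    (by simp) hB (fun t ht hEq => by
      have h1 := hK t (Ico_subset_Icc_self ht)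
      have hp : 0 < w a * Real.exp (-(K + 1) * (t - a)) := mul_pos h0 (Real.exp_pos _)
      have h2 : w t = w a * Real.exp (-(K + 1) * (t - a)) := neg_inj.mp hEq
      rw [abs_of_pos (h2 ▸ hp), h2] at h1
      linarith)
  intro t ht
  have h1 : -w t ≤ _ := key ht
  have hp : 0 < w a * Real.exp (-(K + 1) * (t - a)) := mul_pos h0 (Real.exp_pos _)
  linarith

/-- A function with `-K |w| ≤ w'` that is initially nonnegative stays nonnegative. -/
theorem nonneg_of_neg_mul_abs_le_deriv {w w' : ℝ → ℝ} {a b K : ℝ}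
    (hw : ∀ t ∈ Icc a b, HasDerivWithinAt w (w' t) (Icc a b) t)
    (hK : ∀ t ∈ Icc a b, -(K * |w t|) ≤ w' t) (h0 : 0 ≤ w a) :
    ∀ t ∈ Icc a b, 0 ≤ w t := by
  intro t ht
  refine le_of_forall_pos_le_add fun ε hε => ?_
  -- `δ` is chosen so that the growing barrier equals `ε` at time `t`.
  obtain ⟨δ, hδ, hδε⟩ : ∃ δ > 0, δ * Real.exp ((K + 1) * (t - a)) = ε :=
    ⟨ε * Real.exp (-((K + 1) * (t - a))), by positivity, by
      rw [mul_assoc, ← Real.exp_add]; simp⟩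
  have hB : ∀ x : ℝ, HasDerivAt (fun t => δ * Real.exp ((K + 1) * (t - a)))
      (δ * (Real.exp ((K + 1) * (x - a)) * ((K + 1) * 1))) x := fun x =>
    ((((hasDerivAt_id x).sub_const a).const_mul (K + 1)).exp).const_mul δ
  have key := image_le_of_deriv_right_lt_deriv_boundary (f := fun t => -w t)
    (f' := fun t => -w' t) (a := a) (b := b)
    (fun t ht => (hw t ht).neg.continuousWithinAt)
    (fun t ht => ((hw t (Ico_subset_Icc_self ht)).neg).mono_of_mem_nhdsWithin
      (Icc_mem_nhdsGE_of_mem ht))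
    (by simp; linarith) hB (fun s hs hEq => by
      have h1 := hK s (Ico_subset_Icc_self hs)
      have hp : 0 < δ * Real.exp ((K + 1) * (s - a)) := by positivity
      have h2 : -w s = δ * Real.exp ((K + 1) * (s - a)) := hEq
      rw [← abs_neg, abs_of_pos (h2 ▸ hp), h2] at h1
      linarith)
  have h1 : -w t ≤ _ := key ht
  linarith

/-- A bounded Lipschitz scalar equation with a lower solution `u` and an upper solution `v`, where
`u` does not decrease and `v` does not increase over the interval, has a closed solution between
them; this solution stays strictly above `u`, or below `v`, if it starts so. -/
theorem exists_closed_solution_between {F : ℝ → ℝ → ℝ} {a b : ℝ} {K L : NNReal} (hab : a ≤ b)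
    (hlip : ∀ t ∈ Icc a b, LipschitzWith K (F t))
    (hcont : ∀ x, ContinuousOn (F · x) (Icc a b))
    (hbd : ∀ t ∈ Icc a b, ∀ x, ‖F t x‖ ≤ L)
    {u u' v v' : ℝ → ℝ}
    (hu : ∀ t ∈ Icc a b, HasDerivWithinAt u (u' t) (Icc a b) t)
    (hv : ∀ t ∈ Icc a b, HasDerivWithinAt v (v' t) (Icc a b) t)
    (hu' : ∀ t ∈ Icc a b, u' t ≤ F t (u t))
    (hv' : ∀ t ∈ Icc a b, F t (v t) ≤ v' t)
    (huv : u a ≤ v a) (hub : u a ≤ u b) (hvb : v b ≤ v a) :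
    ∃ y : ℝ → ℝ, (∀ t ∈ Icc a b, HasDerivWithinAt y (F t (y t)) (Icc a b) t) ∧ y a = y b ∧
      (∀ t ∈ Icc a b, u t ≤ y t ∧ y t ≤ v t) ∧
      (u a < y a → ∀ t ∈ Icc a b, u t < y t) ∧
      (y a < v a → ∀ t ∈ Icc a b, y t < v t) := by
  have ha : a ∈ Icc a b := left_mem_Icc.mpr hab
  have hb : b ∈ Icc a b := right_mem_Icc.mpr hab
  obtain ⟨r, hr⟩ : ∃ r : NNReal, (r : ℝ) = v a - u a := ⟨⟨_, sub_nonneg.2 huv⟩, rfl⟩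
  obtain ⟨l, hl⟩ : ∃ l : NNReal, (l : ℝ) = b - a := ⟨⟨_, sub_nonneg.2 hab⟩, rfl⟩
  -- Starting within `r` of `u a` with speed at most `L`, a solution stays in this ball up to time
  -- `b`, so the flow exists on all of `[a, b]`.
  have hPL : IsPicardLindelof F (⟨a, ha⟩ : Icc a b) (u a) (r + L * l) r L K :=
    { lipschitzOnWith := fun t ht => (hlip t ht).lipschitzOnWith
      continuousOn := fun x _ => hcont x
      norm_le := fun t ht x _ => hbd t ht x
      mul_max_le := by simp [hl, hab] }
  obtain ⟨φ, hφ, K', hK'⟩ :=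
    hPL.exists_forall_mem_closedBall_eq_hasDerivWithinAt_lipschitzOnWith
  have hsub : Icc (u a) (v a) ⊆ Metric.closedBall (u a) r := by
    intro x hx
    rw [Metric.mem_closedBall, Real.dist_eq, hr, abs_of_nonneg (sub_nonneg.2 hx.1)]
    linarith [hx.2]
  have hlip' : ∀ t ∈ Icc a b, ∀ x y, |F t x - F t y| ≤ K * |x - y| := fun t ht x y => by
    simpa [Real.dist_eq] using (hlip t ht).dist_le_mul x y
  have hφa : ∀ x ∈ Icc (u a) (v a), φ x a = x := fun x hx => (hφ x (hsub hx)).1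
  have hlow : ∀ x ∈ Icc (u a) (v a), ∀ t ∈ Icc a b,
      HasDerivWithinAt (fun t => φ x t - u t) (F t (φ x t) - u' t) (Icc a b) t :=
    fun x hx t ht => ((hφ x (hsub hx)).2 t ht).sub (hu t ht)
  have hlow' : ∀ x ∈ Icc (u a) (v a), ∀ t ∈ Icc a b,
      -(K * |φ x t - u t|) ≤ F t (φ x t) - u' t := fun x hx t ht => by
    linarith [hu' t ht, (abs_le.1 (hlip' t ht (φ x t) (u t))).1]
  have hup : ∀ x ∈ Icc (u a) (v a), ∀ t ∈ Icc a b,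
      HasDerivWithinAt (fun t => v t - φ x t) (v' t - F t (φ x t)) (Icc a b) t :=
    fun x hx t ht => (hv t ht).sub ((hφ x (hsub hx)).2 t ht)
  have hup' : ∀ x ∈ Icc (u a) (v a), ∀ t ∈ Icc a b,
      -(K * |v t - φ x t|) ≤ v' t - F t (φ x t) := fun x hx t ht => by
    linarith [hv' t ht, (abs_le.1 (hlip' t ht (v t) (φ x t))).1]
  have hbetween : ∀ x ∈ Icc (u a) (v a), ∀ t ∈ Icc a b, u t ≤ φ x t ∧ φ x t ≤ v t :=
    fun x hx t ht =>
      ⟨sub_nonneg.1 (nonneg_of_neg_mul_abs_le_deriv (hlow x hx) (hlow' x hx)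
          (sub_nonneg.2 ((hφa x hx).symm ▸ hx.1)) t ht),
        sub_nonneg.1 (nonneg_of_neg_mul_abs_le_deriv (hup x hx) (hup' x hx)
          (sub_nonneg.2 ((hφa x hx).symm ▸ hx.2)) t ht)⟩
  have hua : u a ∈ Icc (u a) (v a) := left_mem_Icc.2 huv
  have hva : v a ∈ Icc (u a) (v a) := right_mem_Icc.2 huv
  have hc : ContinuousOn (fun x => φ x b - x) (Icc (u a) (v a)) :=
    ((hK' b hb).continuousOn.mono hsub).sub continuousOn_id
  -- The displacement is `≥ 0` at `u a`, since `φ (u a) b ≥ u b ≥ u a`, and `≤ 0` at `v a` likewise.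
  obtain ⟨x, hx, hx0⟩ := intermediate_value_Icc' huv hc
    (show (0 : ℝ) ∈ _ from ⟨by linarith [(hbetween _ hva b hb).2], by linarith [(hbetween _ hua b hb).1]⟩)
  refine ⟨φ x, (hφ x (hsub hx)).2, ?_, hbetween x hx, fun h t ht => ?_, fun h t ht => ?_⟩
  · rw [hφa x hx]; exact (sub_eq_zero.1 hx0).symm
  · exact sub_pos.1 (pos_of_neg_mul_abs_le_deriv (hlow x hx) (hlow' x hx) (sub_pos.2 h) t ht)
  · exact sub_pos.1 (pos_of_neg_mul_abs_le_deriv (hup x hx) (hup' x hx) (sub_pos.2 h) t ht)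

theorem hasDerivWithinAt_integral_Icc {f : ℝ → ℝ} {a b : ℝ} (hf : ContinuousOn f (Icc a b))
    {t : ℝ} (ht : t ∈ Icc a b) :
    HasDerivWithinAt (fun x => ∫ s in a..x, f s) (f t) (Icc a b) t := by
  have : Fact (t ∈ Icc a b) := ⟨ht⟩
  refine intervalIntegral.integral_hasDerivWithinAt_right
    ((hf.mono (uIcc_subset_Icc (left_mem_Icc.2 (ht.1.trans ht.2)) ht)).intervalIntegrable)
    (hf.stronglyMeasurableAtFilter_nhdsWithin measurableSet_Icc t) (hf t ht)

/-! ### The linear comparison equation and the truncated field -/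

section Field

variable {n : ℕ} {a : ℕ → ℝ → ℝ} {t₀ T : ℝ}

theorem continuousOn_alpha (hn : 1 ≤ n) (ha : ∀ k ≤ n, ContinuousOn (a k) (Icc t₀ T)) :
    ContinuousOn (alpha n a) (Icc t₀ T) :=
  (continuousOn_finsetSum _ fun k hk => (ha k (Finset.mem_Icc.1 hk).2).abs).sub (ha 1 hn)

theorem hasDerivWithinAt_theta (hn : 1 ≤ n) (ha : ∀ k ≤ n, ContinuousOn (a k) (Icc t₀ T))
    (c : ℝ) {t : ℝ} (ht : t ∈ Icc t₀ T) :
    HasDerivWithinAt (theta n a t₀ c) (alpha n a t * theta n a t₀ c t - a 0 t) (Icc t₀ T) t := by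
  have hA : ∀ s ∈ Icc t₀ T, HasDerivWithinAt (fun x => ∫ τ in t₀..x, alpha n a τ)
      (alpha n a s) (Icc t₀ T) s :=
    fun s hs => hasDerivWithinAt_integral_Icc (continuousOn_alpha hn ha) hs
  have hJ : HasDerivWithinAt (weightedInt n a t₀)
      (Real.exp (-∫ s in t₀..t, alpha n a s) * a 0 t) (Icc t₀ T) t := by
    refine hasDerivWithinAt_integral_Icc (ContinuousOn.mul (fun s hs => ?_) (ha 0 n.zero_le)) ht
    exact (hA s hs).neg.exp.continuousWithinAt
  refine ((hA t ht).exp.mul (hJ.const_sub c)).congr_deriv ?_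
  have : Real.exp (∫ τ in t₀..t, alpha n a τ) * Real.exp (-∫ τ in t₀..t, alpha n a τ) = 1 := by
    rw [← Real.exp_add]; simp
  unfold theta
  linear_combination -a 0 t * this

theorem thetaMinus_eq_theta (c t : ℝ) : thetaMinus n a t₀ c t = theta n a t₀ (-c) t := by
  simp only [theta, thetaMinus]; ring

theorem theta_left (c : ℝ) : theta n a t₀ c t₀ = c := by
  simp [theta, weightedInt]

/-- As `θ_c(t₀) = c`, this reads the end condition as `θ_c(T) ≤ θ_c(t₀)`. -/
theorem theta_le_iff (c t : ℝ) : theta n a t₀ c t ≤ c ↔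
    c * (1 - Real.exp (-∫ τ in t₀..t, alpha n a τ)) ≤ weightedInt n a t₀ t := by
  rw [theta, ← le_div_iff₀' (Real.exp_pos _), Real.exp_neg, mul_sub, mul_one, div_eq_mul_inv]
  constructor <;> intro h <;> linarith

theorem le_theta_iff (c t : ℝ) : c ≤ theta n a t₀ c t ↔
    weightedInt n a t₀ t ≤ c * (1 - Real.exp (-∫ τ in t₀..t, alpha n a τ)) := by
  rw [theta, ← div_le_iff₀' (Real.exp_pos _), Real.exp_neg, mul_sub, mul_one, div_eq_mul_inv]
  constructor <;> intro h <;> linarith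

/-- Splits off the linear comparison field; for `|x| ≤ 1` each term of the remaining sum has the
sign of `x` or vanishes. -/
theorem neg_sum_eq (hn : 1 ≤ n) (t x : ℝ) :
    -∑ k ∈ Finset.range (n + 1), a k t * x ^ k =
      alpha n a t * x - a 0 t - ∑ k ∈ Finset.Icc 2 n, (|a k t| * x + a k t * x ^ k) := by
  have h : Finset.range (n + 1) = insert 0 (insert 1 (Finset.Icc 2 n)) := by
    ext k; simp; omega
  rw [h, Finset.sum_insert (by simp), Finset.sum_insert (by simp), Finset.sum_add_distrib,
    ← Finset.sum_mul, alpha]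
  ring

theorem abs_pow_le_abs {x : ℝ} (hx : |x| ≤ 1) {k : ℕ} (hk : 2 ≤ k) : |x ^ k| ≤ |x| := by
  rw [abs_pow]
  exact pow_le_of_le_one (abs_nonneg x) hx (by omega)

theorem neg_sum_le_of_nonneg (hn : 1 ≤ n) (t : ℝ) {x : ℝ} (h0 : 0 ≤ x) (h1 : x ≤ 1) :
    -∑ k ∈ Finset.range (n + 1), a k t * x ^ k ≤ alpha n a t * x - a 0 t := by
  rw [neg_sum_eq hn, sub_le_self_iff]
  refine Finset.sum_nonneg fun k hk => ?_
  have h2 : |a k t * x ^ k| ≤ |a k t| * |x| := by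
    rw [abs_mul]
    exact mul_le_mul_of_nonneg_left
      (abs_pow_le_abs (abs_le.2 ⟨by linarith, h1⟩) (Finset.mem_Icc.1 hk).1) (abs_nonneg _)
  rw [abs_of_nonneg h0] at h2
  linarith [(abs_le.1 h2).1]

theorem le_neg_sum_of_nonpos (hn : 1 ≤ n) (t : ℝ) {x : ℝ} (h0 : x ≤ 0) (h1 : -1 ≤ x) :
    alpha n a t * x - a 0 t ≤ -∑ k ∈ Finset.range (n + 1), a k t * x ^ k := by
  rw [neg_sum_eq hn, le_sub_self_iff]
  refine Finset.sum_nonpos fun k hk => ?_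
  have h2 : |a k t * x ^ k| ≤ |a k t| * |x| := by
    rw [abs_mul]
    exact mul_le_mul_of_nonneg_left
      (abs_pow_le_abs (abs_le.2 ⟨h1, by linarith⟩) (Finset.mem_Icc.1 hk).1) (abs_nonneg _)
  rw [abs_of_nonpos h0] at h2
  linarith [(abs_le.1 h2).2]

/-- The vector field of the equation, with the unknown truncated to `[-1, 1]`. -/
noncomputable def truncField (n : ℕ) (a : ℕ → ℝ → ℝ) (t x : ℝ) : ℝ :=
  -∑ k ∈ Finset.range (n + 1), a k t * (projIcc (-1 : ℝ) 1 (by norm_num) x : ℝ) ^ k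

theorem truncField_of_abs_le {x : ℝ} (hx : |x| ≤ 1) (t : ℝ) :
    truncField n a t x = -∑ k ∈ Finset.range (n + 1), a k t * x ^ k := by
  simp only [truncField, projIcc_of_mem _ (abs_le.1 hx)]

theorem continuousOn_truncField (ha : ∀ k ≤ n, ContinuousOn (a k) (Icc t₀ T)) (x : ℝ) :
    ContinuousOn (truncField n a · x) (Icc t₀ T) :=
  (continuousOn_finsetSum _ fun k hk =>
    (ha k (Nat.lt_succ_iff.1 (Finset.mem_range.1 hk))).mul continuousOn_const).neg

/-- Weights `1` give the bound on the truncated field, weights `k` its Lipschitz constant. -/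
theorem exists_sum_mul_abs_le (ha : ∀ k ≤ n, ContinuousOn (a k) (Icc t₀ T)) (w : ℕ → ℝ) :
    ∃ M : NNReal, ∀ t ∈ Icc t₀ T, ∑ k ∈ Finset.range (n + 1), |a k t| * w k ≤ M := by
  have hc : ContinuousOn (fun t => ∑ k ∈ Finset.range (n + 1), |a k t| * w k) (Icc t₀ T) :=
    continuousOn_finsetSum _ fun k hk =>
      (ha k (Nat.lt_succ_iff.1 (Finset.mem_range.1 hk))).abs.mul continuousOn_const
  obtain ⟨C, hC⟩ := isCompact_Icc.exists_bound_of_continuousOn hc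
  exact ⟨C.toNNReal, fun t ht => ((le_abs_self _).trans (hC t ht)).trans (Real.le_coe_toNNReal C)⟩

theorem exists_norm_truncField_le (ha : ∀ k ≤ n, ContinuousOn (a k) (Icc t₀ T)) :
    ∃ L : NNReal, ∀ t ∈ Icc t₀ T, ∀ x, ‖truncField n a t x‖ ≤ L := by
  obtain ⟨M, hM⟩ := exists_sum_mul_abs_le ha 1
  refine ⟨M, fun t ht x => le_trans ?_ (hM t ht)⟩
  rw [truncField, norm_neg]
  refine (norm_sum_le _ _).trans (Finset.sum_le_sum fun k _ => ?_)
  rw [norm_mul, norm_pow, Real.norm_eq_abs, Real.norm_eq_abs]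
  exact mul_le_mul_of_nonneg_left
    (pow_le_one₀ (abs_nonneg _) (abs_le.2 (projIcc (-1 : ℝ) 1 _ x).2)) (abs_nonneg _)

theorem exists_lipschitzWith_truncField (ha : ∀ k ≤ n, ContinuousOn (a k) (Icc t₀ T)) :
    ∃ K : NNReal, ∀ t ∈ Icc t₀ T, LipschitzWith K (truncField n a t) := by
  obtain ⟨M, hM⟩ := exists_sum_mul_abs_le ha (fun k => (k : ℝ))
  refine ⟨M, fun t ht => LipschitzWith.of_dist_le_mul fun x y => ?_⟩
  refine le_trans ?_ (mul_le_mul_of_nonneg_right (hM t ht) dist_nonneg)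
  have hd := (LipschitzWith.projIcc (show (-1 : ℝ) ≤ 1 by norm_num)).dist_le_mul x y
  rw [truncField, truncField, dist_neg_neg, Real.dist_eq, ← Finset.sum_sub_distrib, Finset.sum_mul]
  refine (Finset.abs_sum_le_sum_abs _ _).trans (Finset.sum_le_sum fun k _ => ?_)
  generalize projIcc (-1 : ℝ) 1 (by norm_num) x = p at *
  generalize projIcc (-1 : ℝ) 1 (by norm_num) y = q at *
  rw [← mul_sub, abs_mul, mul_assoc]
  refine mul_le_mul_of_nonneg_left ((abs_pow_sub_pow_le _ _ _).trans ?_) (abs_nonneg _)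
  have hpq : |(p : ℝ) - q| ≤ dist x y := by
    simpa [Subtype.dist_eq, Real.dist_eq] using hd
  have hmax : max |(p : ℝ)| |(q : ℝ)| ^ (k - 1) ≤ 1 :=
    pow_le_one₀ (le_max_of_le_left (abs_nonneg _)) (max_le (abs_le.2 p.2) (abs_le.2 q.2))
  calc |(p : ℝ) - q| * k * max |(p : ℝ)| |(q : ℝ)| ^ (k - 1)
      ≤ |(p : ℝ) - q| * k * 1 := mul_le_mul_of_nonneg_left hmax (by positivity)
    _ = k * |(p : ℝ) - q| := by ring
    _ ≤ k * dist x y := mul_le_mul_of_nonneg_left hpq (by positivity)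

end Field

end PolyODE

theorem theorem5p6 (n : ℕ) (hn : 1 ≤ n) (a : ℕ → ℝ → ℝ) (t₀ T : ℝ) (hT : t₀ < T)
    (ha : ∀ k ≤ n, ContinuousOn (a k) (Set.Icc t₀ T))
    (cp cm : ℝ)
    (hcp : ∀ t ∈ Set.Icc t₀ T, PolyODE.weightedInt n a t₀ t ≤ cp)
    (hcm : ∀ t ∈ Set.Icc t₀ T, -PolyODE.weightedInt n a t₀ t ≤ cm)
    (hθp : ∀ t ∈ Set.Icc t₀ T, PolyODE.theta n a t₀ cp t ≤ 1)
    (hθm : ∀ t ∈ Set.Icc t₀ T, |PolyODE.thetaMinus n a t₀ cm t| ≤ 1)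
    (hendp : cp * (1 - Real.exp (-∫ τ in t₀..T, PolyODE.alpha n a τ)) ≤
      PolyODE.weightedInt n a t₀ T)
    (hendm : cm * (1 - Real.exp (-∫ τ in t₀..T, PolyODE.alpha n a τ)) ≤
      -PolyODE.weightedInt n a t₀ T) :
    ∃ y : ℝ → ℝ, PolyODE.IsClosedSolutionOn n a t₀ T y ∧
      (∀ t ∈ Set.Icc t₀ T,
        PolyODE.thetaMinus n a t₀ cm t ≤ y t ∧ y t ≤ PolyODE.theta n a t₀ cp t) ∧
      (PolyODE.thetaMinus n a t₀ cm t₀ < y t₀ →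
        ∀ t ∈ Set.Icc t₀ T, PolyODE.thetaMinus n a t₀ cm t < y t) ∧
      (y t₀ < PolyODE.theta n a t₀ cp t₀ →
        ∀ t ∈ Set.Icc t₀ T, y t < PolyODE.theta n a t₀ cp t) := by
  have hp0 : ∀ t ∈ Set.Icc t₀ T, 0 ≤ PolyODE.theta n a t₀ cp t := fun t ht =>
    mul_nonneg (Real.exp_pos _).le (sub_nonneg.2 (hcp t ht))
  have hm0 : ∀ t ∈ Set.Icc t₀ T, PolyODE.thetaMinus n a t₀ cm t ≤ 0 := fun t ht =>
    mul_nonpos_of_nonpos_of_nonneg (neg_nonpos.2 (Real.exp_pos _).le) (by linarith [hcm t ht])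
  have ht₀ : t₀ ∈ Set.Icc t₀ T := Set.left_mem_Icc.2 hT.le
  obtain ⟨K, hK⟩ := PolyODE.exists_lipschitzWith_truncField ha
  obtain ⟨L, hL⟩ := PolyODE.exists_norm_truncField_le ha
  obtain ⟨y, hy, hclosed, hbetween, hlow, hup⟩ := PolyODE.exists_closed_solution_between hT.le hK
    (PolyODE.continuousOn_truncField ha) hL
    (u := PolyODE.thetaMinus n a t₀ cm) (v := PolyODE.theta n a t₀ cp)
    (u' := fun t => PolyODE.alpha n a t * PolyODE.thetaMinus n a t₀ cm t - a 0 t)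
    (fun t ht => by
      rw [funext (PolyODE.thetaMinus_eq_theta cm)]
      exact PolyODE.hasDerivWithinAt_theta hn ha _ ht)
    (fun t ht => PolyODE.hasDerivWithinAt_theta hn ha cp ht)
    (fun t ht => by
      rw [PolyODE.truncField_of_abs_le (hθm t ht)]
      exact PolyODE.le_neg_sum_of_nonpos hn t (hm0 t ht) (abs_le.1 (hθm t ht)).1)
    (fun t ht => by
      rw [PolyODE.truncField_of_abs_le (abs_le.2 ⟨by linarith [hp0 t ht], hθp t ht⟩)]
      exact PolyODE.neg_sum_le_of_nonneg hn t (hp0 t ht) (hθp t ht))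
    ((hm0 t₀ ht₀).trans (hp0 t₀ ht₀))
    (by
      rw [PolyODE.thetaMinus_eq_theta, PolyODE.thetaMinus_eq_theta, PolyODE.theta_left,
        PolyODE.le_theta_iff]
      linarith)
    (by
      rw [PolyODE.theta_left, PolyODE.theta_le_iff]
      exact hendp)
  refine ⟨y, ⟨fun t ht => ?_, hclosed⟩, hbetween, hlow, hup⟩
  -- Both barriers confine `y` to `[-1, 1]`, so it solves the original equation.
  have hyt : |y t| ≤ 1 := abs_le.2 ⟨(abs_le.1 (hθm t ht)).1.trans (hbetween t ht).1,
    (hbetween t ht).2.trans (hθp t ht)⟩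
  rw [← PolyODE.truncField_of_abs_le hyt]
  exact hy t ht
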